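/- Let $\mathbb K\in\{\mathbb R,\mathbb C\}$, let $\mathfrak k$ be a finite-dimensional Lie algebra over $\mathbb K$, let $M$ be a smooth, finite-dimensional, Hausdorff, paracompact, connected real manifold, and let $\pi:\mathbb L\to M$ be a bundle of Lie algebras with fiber $\mathfrak k$, i.e. a smooth $\mathbb K$-vector bundle with a bundle atlas whose transition maps take values in $\operatorname{Aut}(\mathfrak k)$; each fiber $\mathbb L_x$ carries the Lie bracket transported from $\mathfrak k$ by the bundle charts. For $k\in\{0,1,2,\dots\}\cup\{\infty\}$ let $\Gamma^k(\mathbb L)$ be the $\mathbb K$-Lie algebra of $C^k$-sections of $\mathbb L$ with pointwise operations. For a $C^k$-diffeomorphism $\lambda:M\to M$ (a homeomorphism if $k=0$) let $\operatorname{Aut}_\lambda(\mathbb L)$ be the $C^k$ fiber bundle over $M$ whose fiber at $x$ is the set of all $\mathbb K$-Lie algebra isomorphisms $f:\mathbb L_x\to\mathbb L_{\lambda(x)}$, with the charts $f\mapsto (x,\varphi'_{\lambda(x)}\circ f\circ\varphi_x^{-1})\in M\times\operatorname{Aut}(\mathfrak k)$ obtained from bundle charts $\varphi,\varphi'$ of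 $\mathbb L$ around $x$ and $\lambda(x)$, and let $\operatorname{Aut}(\mathbb L):=\operatorname{Aut}_{\operatorname{id}_M}(\mathbb L)$. Suppose that one of the following holds: 1. $\mathbb K=\mathbb C$ and $\mathfrak k$ is a simple complex Lie algebra; 2. $\mathbb K=\mathbb R$ and $\mathfrak k$ is a simple real Lie algebra that is isomorphic to the Lie algebra of a compact Lie group. Then for every $k\in\{0,1,2,\dots\}\cup\{\infty\}$ and every ($\mathbb K$-linear) Lie algebra automorphism $\mu$ of $\Gamma^k(\mathbb L)$ there are a $C^k$-diffeomorphism $\lambda:M\to M$ and a $C^k$-section $\mu_0\in\Gamma^k(\operatorname{Aut}_\lambda(\mathbb L))$, i.e. a $C^k$ family of Lie algebra isomorphisms $\mu_0(x):\mathbb L_x\to\mathbb L_{\lambda(x)}$ $(x\in M)$, such that $$(\mu X)(\lambda(x))=\mu_0(x)\bigl(X(x)\bigr)\qquad\text{for all }X\in\Gamma^k(\mathbb L),\ x\in M.$$ Moreover, the map $\operatorname{Aut}_\lambda(\mathbb L)\to\operatorname{Aut}(\mathbb L)$, $$\bigl(f:\mathbb L_x\to\mathbb L_{\lambda(x)}\bigr)\longmapsto\bigl(\mu_0(x)^{-1}\circ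 f:\mathbb L_x\to\mathbb L_x\bigr),$$ is an isomorphism of $C^k$ fiber bundles over $\operatorname{id}_M$. -/

import Mathlib

open Bundle Set
open scoped Manifold ContDiff

universe w

noncomputable section

/-- A Lie ring whose additive group carries a norm. It is only used on finite-dimensional Lie
algebras, where all norms give the same topology and the same smooth structure. -/
class NormedLieRing (L : Type*) extends NormedAddCommGroup L, LieRing L

/-- A Lie algebra which is at the same time a normed space, for the same scalar multiplication. -/
class NormedLieAlgebra (R : Type*) (L : Type*) [NormedField R] [NormedLieRing L] extends
  NormedSpace R L, LieAlgebra R L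

/-- A smooth real Lie group is regular enough for the bracket on its Lie algebra. -/
instance lieGroupMinSmoothness {F : Type*} [NormedAddCommGroup F] [NormedSpace ℝ F]
    {H : Type*} [TopologicalSpace H] {I : ModelWithCorners ℝ F H}
    {G : Type*} [TopologicalSpace G] [ChartedSpace H G] [Group G] [LieGroup I ∞ G] :
    LieGroup I (minSmoothness ℝ 3) G :=
  LieGroup.of_le (n := ∞) (by
    rw [minSmoothness_of_isRCLikeNormedField]
    exact WithTop.coe_le_coe.2 (le_top : (3 : ℕ∞) ≤ ⊤))

/-- The real Lie algebra `L` is isomorphic to the Lie algebra of a compact Lie group `G`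
(a smooth, finite-dimensional, Hausdorff one; connectedness of `G` is not required). -/
def IsLieAlgebraOfCompactLieGroup (L : Type*) [LieRing L] [LieAlgebra ℝ L] : Prop :=
  ∃ (n : ℕ) (G : Type w) (_ : TopologicalSpace G)
    (_ : ChartedSpace (EuclideanSpace ℝ (Fin n)) G) (_ : Group G)
    (_ : LieGroup (𝓡 n) ∞ G) (_ : CompactSpace G) (_ : T2Space G),
    Nonempty (L ≃ₗ⁅ℝ⁆ GroupLieAlgebra (𝓡 n) G)

/-- The pointwise Lie bracket on a product of Lie rings. -/
instance piLieRing {ι : Type*} {E : ι → Type*} [∀ x, LieRing (E x)] : LieRing (∀ x, E x) where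
  bracket X Y := fun x => ⁅X x, Y x⁆
  add_lie X Y Z := funext fun x => add_lie (X x) (Y x) (Z x)
  lie_add X Y Z := funext fun x => lie_add (X x) (Y x) (Z x)
  lie_self X := funext fun x => lie_self (X x)
  leibniz_lie X Y Z := funext fun x => leibniz_lie (X x) (Y x) (Z x)

instance piLieAlgebra {R ι : Type*} [CommRing R] {E : ι → Type*} [∀ x, LieRing (E x)]
    [∀ x, LieAlgebra R (E x)] : LieAlgebra R (∀ x, E x) where
  lie_smul c X Y := funext fun x => lie_smul c (X x) (Y x)

section LieBundle

variable (𝕂 : Type*) [RCLike 𝕂]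
  (EM : Type*) [NormedAddCommGroup EM] [NormedSpace ℝ EM]
  {M : Type*} [TopologicalSpace M] [ChartedSpace EM M]
  (𝔨 : Type*) [NormedLieRing 𝔨] [NormedLieAlgebra 𝕂 𝔨] [NormedLieAlgebra ℝ 𝔨]
  [IsScalarTower ℝ 𝕂 𝔨]
  (L : M → Type*) [∀ x, LieRing (L x)] [∀ x, LieAlgebra 𝕂 (L x)]
  [∀ x, Module ℝ (L x)] [∀ x, IsScalarTower ℝ 𝕂 (L x)]
  [∀ x, TopologicalSpace (L x)] [TopologicalSpace (TotalSpace 𝔨 L)] [FiberBundle 𝔨 L]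

/-- The bundle charts are compatible with the Lie brackets: on the fibre over each point of its
base set, every chart of the bundle atlas preserves brackets. Together with `VectorBundle 𝕂 𝔨 L`
and `ContMDiffVectorBundle ∞ 𝔨 L` this says that `L` is a (smooth) bundle of Lie algebras with
fibre `𝔨`: the cocycle of its atlas has values in `Aut 𝔨`, and the bracket of each fibre `L x` is
the one transported from `𝔨` by any chart around `x`. -/
class IsLieBundle : Prop where
  map_lie : ∀ (e : Trivialization 𝔨 (π 𝔨 L)) [MemTrivializationAtlas e], ∀ x ∈ e.baseSet,
    ∀ v w : L x, (e ⟨x, ⁅v, w⁆⟩).2 = ⁅(e ⟨x, v⟩).2, (e ⟨x, w⟩).2⁆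

variable [FiniteDimensional ℝ 𝔨] [IsManifold 𝓘(ℝ, EM) ∞ M]
  [VectorBundle 𝕂 𝔨 L] [VectorBundle ℝ 𝔨 L] [ContMDiffVectorBundle ∞ 𝔨 L 𝓘(ℝ, EM)]
  [IsLieBundle 𝔨 L]

/-- The Lie algebra `Γ^k(L)` of `C^k` sections, as a Lie subalgebra of the product of all fibres:
sums, scalar multiples and brackets of sections are pointwise. -/
def sectionLieAlgebra (k : ℕ∞) : LieSubalgebra 𝕂 (∀ x, L x) where
  carrier := {X | ContMDiff 𝓘(ℝ, EM) (𝓘(ℝ, EM).prod 𝓘(ℝ, 𝔨)) k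
    (fun x => TotalSpace.mk' 𝔨 x (X x))}
  add_mem' := fun {X Y} hX hY => ContMDiff.add_section hX hY
  zero_mem' := Bundle.contMDiff_zeroSection ℝ L
  smul_mem' := fun c X hX x => by
    have hx : x ∈ (trivializationAt 𝔨 L x).baseSet := FiberBundle.mem_baseSet_trivializationAt' x
    rw [Bundle.contMDiffAt_section]
    have h := (Bundle.contMDiffAt_section x).1 (hX x)
    let T : 𝔨 →L[ℝ] 𝔨 := LinearMap.toContinuousLinearMap
      ((c • LinearMap.id : 𝔨 →ₗ[𝕂] 𝔨).restrictScalars ℝ)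
    refine (T.contMDiff.contMDiffAt.comp x h).congr_of_eventuallyEq ?_
    filter_upwards [(trivializationAt 𝔨 L x).open_baseSet.mem_nhds hx] with y hy
    exact ((trivializationAt 𝔨 L x).linear 𝕂 hy).map_smul c (X y)
  lie_mem' := fun {X Y} hX hY x => by
    have hx : x ∈ (trivializationAt 𝔨 L x).baseSet := FiberBundle.mem_baseSet_trivializationAt' x
    rw [Bundle.contMDiffAt_section]
    have h := (Bundle.contMDiffAt_section x).1 (hX x)
    have h' := (Bundle.contMDiffAt_section x).1 (hY x)
    let B : 𝔨 →L[ℝ] 𝔨 →L[ℝ] 𝔨 := LinearMap.toContinuousLinearMap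
      ((LinearMap.toContinuousLinearMap : (𝔨 →ₗ[ℝ] 𝔨) ≃ₗ[ℝ] _).toLinearMap ∘ₗ
        LinearMap.mk₂ ℝ (fun v w : 𝔨 => ⁅v, w⁆) add_lie smul_lie lie_add
          (fun c v w => lie_smul c v w))
    refine ((B.contMDiff.contMDiffAt.comp x h).clm_apply h').congr_of_eventuallyEq ?_
    filter_upwards [(trivializationAt 𝔨 L x).open_baseSet.mem_nhds hx] with y hy
    exact IsLieBundle.map_lie (trivializationAt 𝔨 L x) y hy (X y) (Y y)

/-- The total space of the bundle `Aut_l(L)` over `M` belonging to a map `l : M → M`: its fibre over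
`x` is the set of all Lie algebra isomorphisms `L x → L (l x)`, and a point of it is a pair
`⟨x, f⟩`. For `l = id` this is the bundle `Aut(L)`. -/
def LieIsoBundle (l : M → M) : Type _ := Σ x : M, L x ≃ₗ⁅𝕂⁆ L (l x)

variable {𝕂 L}

/-- The expression `e'_{l x} ∘ f ∘ e_x⁻¹ : 𝔨 → 𝔨` of a point `⟨x, f⟩` of `Aut_l(L)` in a chart `e` of
`L` around `x` and a chart `e'` of `L` around `l x` (it is only used at such points, where it is an
element of the group `Aut 𝔨`). -/
def LieIsoBundle.inCharts {l : M → M} (e e' : Trivialization 𝔨 (π 𝔨 L)) [MemTrivializationAtlas e]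
    [MemTrivializationAtlas e'] (p : LieIsoBundle 𝕂 L l) : 𝔨 →L[ℝ] 𝔨 :=
  LinearMap.toContinuousLinearMap
    (e'.linearMapAt ℝ (l p.1) ∘ₗ (p.2 : L p.1 →ₗ[𝕂] L (l p.1)).restrictScalars ℝ ∘ₗ
      e.symmₗ ℝ p.1)

/-- A map `γ` from a subset `W` of a manifold `N` to `Aut_l(L)` is of class `C^k`: its base
component is, and so is its expression in any two charts of `L`, wherever that is defined. This is
smoothness with respect to the charts
`⟨x, f⟩ ↦ (x, e'_{l x} ∘ f ∘ e_x⁻¹) ∈ M × Aut 𝔨` of `Aut_l(L)`, where the closed subgroup `Aut 𝔨` is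
regarded as a submanifold of the space of endomorphisms of `𝔨`. -/
def LieIsoBundle.IsCkOn (k : ℕ∞) {l : M → M} (EN : Type*) [NormedAddCommGroup EN]
    [NormedSpace ℝ EN] {N : Type*} [TopologicalSpace N] [ChartedSpace EN N]
    (γ : N → LieIsoBundle 𝕂 L l) (W : Set N) : Prop :=
  ContMDiffOn 𝓘(ℝ, EN) 𝓘(ℝ, EM) k (fun y => (γ y).1) W ∧
  ∀ (e e' : Trivialization 𝔨 (π 𝔨 L)) [MemTrivializationAtlas e] [MemTrivializationAtlas e'],
    ContMDiffOn 𝓘(ℝ, EN) 𝓘(ℝ, 𝔨 →L[ℝ] 𝔨) k (fun y => (γ y).inCharts 𝔨 e e')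
      (W ∩ {y | (γ y).1 ∈ e.baseSet ∧ l (γ y).1 ∈ e'.baseSet})

/-- The family `κ x : L x → L (l x)` of Lie algebra isomorphisms is a `C^k` section of `Aut_l(L)`,
that is, an element of `Γ^k(Aut_l(L))`. -/
def IsCkLieIsoSection (k : ℕ∞) {l : M → M} (κ : ∀ x, L x ≃ₗ⁅𝕂⁆ L (l x)) : Prop :=
  LieIsoBundle.IsCkOn EM 𝔨 k EM (fun x : M => (⟨x, κ x⟩ : LieIsoBundle 𝕂 L l)) univ

/-- `Φ : Aut_l(L) → Aut_{l'}(L)` is an isomorphism of `C^k` fibre bundles over the identity of `M`,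
that is, a fibre-preserving `C^k` diffeomorphism. Since `Aut_l(L)` and `Aut_{l'}(L)` are locally
`C^k` diffeomorphic to open subsets of some `ℝⁿ`, a bijection between them is a `C^k` diffeomorphism
if and only if it and its inverse carry `C^k` maps defined on open subsets of `ℝⁿ` to `C^k` maps. -/
def IsCkBundleIso (k : ℕ∞) {l l' : M → M} (Φ : LieIsoBundle 𝕂 L l → LieIsoBundle 𝕂 L l') : Prop :=
  Function.Bijective Φ ∧ (∀ p, (Φ p).1 = p.1) ∧
  ∀ (n : ℕ) (W : Set (EuclideanSpace ℝ (Fin n))), IsOpen W →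
    ∀ γ : EuclideanSpace ℝ (Fin n) → LieIsoBundle 𝕂 L l,
      LieIsoBundle.IsCkOn EM 𝔨 k (EuclideanSpace ℝ (Fin n)) γ W ↔
        LieIsoBundle.IsCkOn EM 𝔨 k (EuclideanSpace ℝ (Fin n)) (Φ ∘ γ) W

end LieBundle
end

/-!
Evaluation at a point `x`, followed by a chart of the fibre, is a surjection of the Lie algebra `Γ`
of sections onto the simple Lie algebra `𝔨`. The point of the proof is that `Γ` has no other
surjections onto `𝔨`, up to automorphisms of `𝔨`: the kernel of any surjection `ψ : Γ → 𝔨` is the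
ideal of the sections vanishing at some `y : M` (`exists_map_eq_zero_iff_apply_eq_zero`). An
automorphism of `Γ` therefore permutes these ideals, that is, the points of `M`.

For a real function `f` and sections `X`, `Y` one has `⁅Y, f X⁆ = ⁅f Y, X⁆`. As `𝔨` has no centre,
the kernel of `ψ` is stable under multiplication by functions (`map_fsmul_eq_zero`), so each `f`
induces an endomorphism of `𝔨` which commutes with all `ad v` and is zero or injective by
simplicity. The functions inducing zero form a prime ideal `P`, whose residue ring is algebraic over
`ℝ` because `𝔨` is finite-dimensional. A connected paracompact manifold is σ-compact, hence carries
a proper function, and this forces the members of `P` to have a common zero `y`; thus `P` is the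
ideal of `y` (`exists_mem_iff_eq_zero_of_isPrime`). A section vanishing at `y` is a combination of
sections with coefficients vanishing at `y`, so `ψ` kills it, and simplicity of `𝔨` gives equality
of the two kernels.

If `μ` moves the ideal of `m x` to the ideal of `x`, then `μ (f X) = (f ∘ m) μ X`, so that `m` pulls
`C^k` functions back to `C^k` functions and is of class `C^k` itself
(`contMDiff_of_apply_eq_zero_iff`). The same holds for `μ⁻¹`, so `m` is a diffeomorphism, and `l` is
its inverse. As `X ↦ X x` and `X ↦ (μ X) (l x)` have the same kernel, they differ by an isomorphism
`κ x` of the fibres. Applying `μ` and `μ⁻¹` to sections which are constant in a chart shows that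
`κ` and its inverse are of class `C^k` (`contMDiffAt_chartExpr`), and the statement on the bundle
isomorphism follows by composing with them (`LieIsoBundle.IsCkOn.trans`).
-/

open scoped Topology

noncomputable section

/-! ### Proper functions and maximal ideals of the algebra of functions -/

/-- Starting from one compact set, repeatedly add the compact neighbourhoods that belong to those
members of a locally finite cover which meet what has been reached so far. Each stage is compact,
and the union of the stages is open and closed. -/
theorem sigmaCompactSpace_of_connectedSpace {X : Type*} [TopologicalSpace X] [LocallyCompactSpace X]
    [ParacompactSpace X] [ConnectedSpace X] : SigmaCompactSpace X := by
  have hN : ∀ x : X, ∃ N, IsCompact N ∧ x ∈ interior N := fun x => exists_compact_mem_nhds x |>.imp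
    fun N h => ⟨h.1, mem_interior_iff_mem_nhds.2 h.2⟩
  choose N hNc hNx using hN
  obtain ⟨v, hvo, hvc, hvf, hvN⟩ := precise_refinement (fun x => interior (N x))
    (fun x => isOpen_interior) (eq_univ_of_forall fun x => mem_iUnion.2 ⟨x, hNx x⟩)
  have hcov : ∀ x, ∃ i, x ∈ v i := fun x => mem_iUnion.1 (hvc ▸ mem_univ x)
  obtain ⟨x₀⟩ := (inferInstance : Nonempty X)
  let K : ℕ → Set X := fun n => Nat.rec (N x₀) (fun _ S => ⋃ i ∈ {i | (v i ∩ S).Nonempty}, N i) n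
  have hK : ∀ n, IsCompact (K n) := by
    intro n
    induction n with
    | zero => exact hNc x₀
    | succ n ih => exact (hvf.finite_nonempty_inter_compact ih).isCompact_biUnion fun i _ => hNc i
  have hstep : ∀ n i, (v i ∩ K n).Nonempty → v i ⊆ K (n + 1) := fun n i hi x hx =>
    mem_iUnion₂.2 ⟨i, hi, interior_subset (hvN i hx)⟩
  have hclopen : IsClopen (⋃ n, K n) := by
    constructor
    · refine isClosed_of_closure_subset fun x hx => ?_
      obtain ⟨i, hi⟩ := hcov x
      obtain ⟨y, hyv, hyK⟩ := mem_closure_iff.1 hx (v i) (hvo i) hi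
      obtain ⟨n, hn⟩ := mem_iUnion.1 hyK
      exact mem_iUnion.2 ⟨n + 1, hstep n i ⟨y, hyv, hn⟩ hi⟩
    · refine isOpen_iff_mem_nhds.2 fun x hx => ?_
      obtain ⟨n, hn⟩ := mem_iUnion.1 hx
      obtain ⟨i, hi⟩ := hcov x
      exact Filter.mem_of_superset ((hvo i).mem_nhds hi) ((hstep n i ⟨x, hi, hn⟩).trans
        (subset_iUnion K (n + 1)))
  exact SigmaCompactSpace_iff_exists_compact_covering.2 ⟨K, hK, hclopen.eq_univ
    ⟨x₀, mem_iUnion.2 ⟨0, interior_subset (hNx x₀)⟩⟩⟩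

section Functions

variable {EM : Type*} [NormedAddCommGroup EM] [NormedSpace ℝ EM]
  {M : Type*} [TopologicalSpace M] [ChartedSpace EM M]

theorem ContMDiffMap.aeval_apply {k : ℕ∞} (f : C^k⟮𝓘(ℝ, EM), M; 𝓘(ℝ, ℝ), ℝ⟯)
    (p : Polynomial ℝ) (x : M) : (Polynomial.aeval f p) x = p.eval (f x) := by
  induction p using Polynomial.induction_on' with
  | add p q hp hq => simp [hp, hq]
  | monomial n a =>
    simp only [Polynomial.aeval_monomial, Polynomial.eval_monomial]
    rfl

theorem ContMDiffMap.isUnit_of_ne_zero {k : ℕ∞} (f : C^k⟮𝓘(ℝ, EM), M; 𝓘(ℝ, ℝ), ℝ⟯)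
    (hf : ∀ x, f x ≠ 0) : IsUnit f := by
  refine IsUnit.of_mul_eq_one ⟨fun x => (f x)⁻¹, f.contMDiff.inv₀ hf⟩ ?_
  ext x
  exact mul_inv_cancel₀ (hf x)

variable [FiniteDimensional ℝ EM] [IsManifold 𝓘(ℝ, EM) ∞ M] [T2Space M]

/-- A `C^k` function bounding from below the index of a point in a compact exhaustion. -/
theorem exists_contMDiffMap_isCompact_sublevel [SigmaCompactSpace M] (k : ℕ∞) :
    ∃ f : C^k⟮𝓘(ℝ, EM), M; 𝓘(ℝ, ℝ), ℝ⟯, ∀ c : ℝ, IsCompact {x | f x ≤ c} := by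
  have : LocallyCompactSpace M := Manifold.locallyCompact_of_finiteDimensional 𝓘(ℝ, EM)
  let K := CompactExhaustion.choice M
  obtain ⟨f, hf⟩ := exists_contMDiffMap_forall_mem_convex_of_local_const (n := k) 𝓘(ℝ, EM)
    (t := fun x : M => Set.Ici (K.find x : ℝ)) (fun x => convex_Ici _) (by
      intro x
      obtain ⟨n, hn⟩ := mem_iUnion.1 (K.iUnion_eq ▸ mem_univ x : x ∈ ⋃ n, K n)
      refine ⟨((n + 1 : ℕ) : ℝ), ?_⟩
      filter_upwards [isOpen_interior.mem_nhds (K.subset_interior_succ n hn)] with y hy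
      exact (Nat.cast_le (α := ℝ)).2 ((K.mem_iff_find_le).1 (interior_subset hy)))
  refine ⟨f, fun c => ?_⟩
  obtain ⟨n, hn⟩ := exists_nat_ge c
  refine (K.isCompact n).of_isClosed_subset (isClosed_le f.contMDiff.continuous continuous_const)
    fun x hx => K.mem_iff_find_le.2 ?_
  exact (Nat.cast_le (α := ℝ)).1 (((hf x).trans hx).trans hn)

/-- If `f` is a proper function, then a nonzero polynomial in `f` vanishes only on a compact set.
Such a function lies in `P`, and if each point of this compact set were missed by the zero set of
some member of `P`, a finite sum of squares in `P` would have no zeros at all. -/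
theorem exists_forall_mem_eq_zero_of_isAlgebraic_quotient [SigmaCompactSpace M] {k : ℕ∞}
    (P : Ideal C^k⟮𝓘(ℝ, EM), M; 𝓘(ℝ, ℝ), ℝ⟯) (hP : P ≠ ⊤)
    [Algebra.IsAlgebraic ℝ (C^k⟮𝓘(ℝ, EM), M; 𝓘(ℝ, ℝ), ℝ⟯ ⧸ P)] :
    ∃ y : M, ∀ f ∈ P, f y = 0 := by
  obtain ⟨f, hf⟩ := exists_contMDiffMap_isCompact_sublevel (EM := EM) (M := M) k
  obtain ⟨p, hp, hpf⟩ := Algebra.IsAlgebraic.isAlgebraic (R := ℝ) (Ideal.Quotient.mk P f)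
  have hpP : Polynomial.aeval f p ∈ P := by
    rw [← Ideal.Quotient.eq_zero_iff_mem, ← hpf]
    exact (Polynomial.aeval_algHom_apply (Ideal.Quotient.mkₐ ℝ P) f p).symm
  by_contra! hcon
  choose g hgP hg using hcon
  have hZ : IsCompact {x | p.eval (f x) = 0} := by
    obtain ⟨c, hc⟩ := (p.roots.toFinset.finite_toSet).bddAbove
    refine (hf c).of_isClosed_subset
      (isClosed_eq (p.continuous.comp f.contMDiff.continuous) continuous_const) fun x hx => hc ?_
    simpa [hp] using hx
  obtain ⟨t, ht⟩ := hZ.elim_nhds_subcover (fun y => {x | g y x ≠ 0}) fun y _ =>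
    (isOpen_ne_fun (g y).contMDiff.continuous continuous_const).mem_nhds (hg y)
  let s := Polynomial.aeval f p * Polynomial.aeval f p + ∑ y ∈ t, g y * g y
  have hsP : s ∈ P := P.add_mem (P.mul_mem_left _ hpP)
    (P.sum_mem fun y _ => P.mul_mem_left _ (hgP y))
  -- A zero of `s` is a zero of `p ∘ f` at which all `g y`, `y ∈ t`, vanish, but these have no common
  -- zero there.
  refine hP (P.eq_top_of_isUnit_mem hsP (s.isUnit_of_ne_zero fun x hx => ?_))
  have hsum : ∀ (u : Finset M), (∑ y ∈ u, g y * g y) x = ∑ y ∈ u, g y x * g y x := fun u =>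
    map_sum (ContMDiffMap.evalRingHom x) _ u
  have hx' : p.eval (f x) * p.eval (f x) + ∑ y ∈ t, g y x * g y x = 0 := by
    rw [← hsum, ← ContMDiffMap.aeval_apply]
    exact hx
  have h0 : 0 ≤ ∑ y ∈ t, g y x * g y x := Finset.sum_nonneg fun y _ => mul_self_nonneg _
  have h1 : p.eval (f x) = 0 := mul_self_eq_zero.1 (by nlinarith [mul_self_nonneg (p.eval (f x))])
  have h2 : ∑ y ∈ t, g y x * g y x = 0 := by rw [h1] at hx'; linarith
  obtain ⟨y, hyt, hy⟩ := mem_iUnion₂.1 (ht.2 h1)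
  exact hy (mul_self_eq_zero.1
    ((Finset.sum_eq_zero_iff_of_nonneg fun y _ => mul_self_nonneg (g y x)).1 h2 y hyt))

/-- A prime ideal with algebraic residue ring is maximal, hence it is the ideal of a point. -/
theorem exists_mem_iff_eq_zero_of_isPrime [SigmaCompactSpace M] {k : ℕ∞}
    (P : Ideal C^k⟮𝓘(ℝ, EM), M; 𝓘(ℝ, ℝ), ℝ⟯) [P.IsPrime]
    [Algebra.IsAlgebraic ℝ (C^k⟮𝓘(ℝ, EM), M; 𝓘(ℝ, ℝ), ℝ⟯ ⧸ P)] :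
    ∃ y : M, ∀ f, f ∈ P ↔ f y = 0 := by
  obtain ⟨y, hy⟩ := exists_forall_mem_eq_zero_of_isAlgebraic_quotient P Ideal.IsPrime.ne_top'
  have hmax : P.IsMaximal := Ideal.Quotient.maximal_of_isField _
    (isField_of_isIntegral_of_isField' (R := ℝ) (Field.toIsField ℝ))
  have hle : P ≤ RingHom.ker (ContMDiffMap.evalRingHom (n := k) (I := 𝓘(ℝ, EM)) (I' := 𝓘(ℝ, ℝ))
    (R := ℝ) y) := hy
  have heq := hmax.eq_of_le (RingHom.ker_ne_top _) hle
  exact ⟨y, fun f => ⟨hy f, fun h => by rw [heq]; exact h⟩⟩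

end Functions

/-! ### Surjections onto a simple Lie algebra -/

section Simple

variable {𝕂 𝔨 Γ : Type*} [CommRing 𝕂] [LieRing 𝔨] [LieAlgebra 𝕂 𝔨] [LieRing Γ] [LieAlgebra 𝕂 Γ]

theorem LieAlgebra.IsSimple.eq_zero_of_forall_lie_eq_zero [LieAlgebra.IsSimple 𝕂 𝔨] {v : 𝔨}
    (hv : ∀ w : 𝔨, ⁅w, v⁆ = 0) : v = 0 := by
  have hmem : v ∈ LieAlgebra.center 𝕂 𝔨 := hv
  rcases LieAlgebra.IsSimple.eq_bot_or_eq_top (R := 𝕂) (LieAlgebra.center 𝕂 𝔨) with hc | hc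
  · rw [hc] at hmem
    exact hmem
  · exact absurd ((LieAlgebra.isLieAbelian_iff_center_eq_top 𝕂 𝔨).2 hc)
      (LieAlgebra.IsSimple.non_abelian 𝕂)

/-- A nonzero ideal of a simple Lie algebra, given by a predicate, is everything. -/
theorem LieAlgebra.IsSimple.forall_of_exists [LieAlgebra.IsSimple 𝕂 𝔨] (p : 𝔨 → Prop) (h0 : p 0)
    (hadd : ∀ v w, p v → p w → p (v + w)) (hsmul : ∀ (c : 𝕂) v, p v → p (c • v))
    (hlie : ∀ v w : 𝔨, p w → p ⁅v, w⁆) {v : 𝔨} (hv : p v) (hv0 : v ≠ 0) (w : 𝔨) : p w := by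
  let N : LieIdeal 𝕂 𝔨 :=
    { carrier := {v | p v}
      zero_mem' := h0
      add_mem' := fun {v w} => hadd v w
      smul_mem' := hsmul
      lie_mem := fun {v w} => hlie v w }
  rcases LieAlgebra.IsSimple.eq_bot_or_eq_top (R := 𝕂) N with hN | hN
  · have hvN : v ∈ N := hv
    rw [hN] at hvN
    exact absurd hvN hv0
  · have hwN : w ∈ N := by rw [hN]; trivial
    exact hwN

/-- The kernel of a surjection onto a simple Lie algebra is a maximal ideal. -/
theorem LieHom.ker_iff_of_ker_le [LieAlgebra.IsSimple 𝕂 𝔨] (φ ψ : Γ →ₗ⁅𝕂⁆ 𝔨)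
    (hφ : Function.Surjective φ) (hψ : Function.Surjective ψ) (hle : ∀ X, φ X = 0 → ψ X = 0)
    (X : Γ) : ψ X = 0 ↔ φ X = 0 := by
  refine ⟨fun hX => by_contra fun hX0 => ?_, hle X⟩
  have hker : ∀ Y Z, φ Y = φ Z → ψ Y = 0 → ψ Z = 0 := fun Y Z hYZ hY => by
    have := hle (Z - Y) (by rw [map_sub, hYZ, sub_self])
    rwa [map_sub, hY, sub_zero] at this
  have hall := LieAlgebra.IsSimple.forall_of_exists (𝕂 := 𝕂) (fun v => ∃ Y, φ Y = v ∧ ψ Y = 0)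
    ⟨0, by simp, by simp⟩
    (fun v w ⟨Y, hY, hY'⟩ ⟨Z, hZ, hZ'⟩ => ⟨Y + Z, by simp [hY, hZ], by simp [hY', hZ']⟩)
    (fun c v ⟨Y, hY, hY'⟩ => ⟨c • Y, by simp [hY], by simp [hY']⟩)
    (fun v w ⟨Y, hY, hY'⟩ => by
      obtain ⟨Z, hZ⟩ := hφ v
      exact ⟨⁅Z, Y⁆, by simp [hY, hZ], by simp [hY']⟩) ⟨X, rfl, hX⟩ hX0
  obtain ⟨v, hv⟩ := @exists_ne _ (LieAlgebra.IsSimple.nontrivial 𝕂 𝔨) (0 : 𝔨)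
  obtain ⟨Y, rfl⟩ := hψ v
  obtain ⟨Z, hZ, hZ'⟩ := hall (φ Y)
  exact hv (hker Z Y hZ hZ')

end Simple

section RealScalars

variable {𝕂 : Type*} [RCLike 𝕂]

theorem lie_real_smul {V : Type*} [LieRing V] [LieAlgebra 𝕂 V] [Module ℝ V] [IsScalarTower ℝ 𝕂 V]
    (r : ℝ) (v w : V) : ⁅v, r • w⁆ = r • ⁅v, w⁆ := by
  rw [← algebraMap_smul 𝕂 r w, ← algebraMap_smul 𝕂 r, lie_smul]

theorem real_smul_lie {V : Type*} [LieRing V] [LieAlgebra 𝕂 V] [Module ℝ V] [IsScalarTower ℝ 𝕂 V]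
    (r : ℝ) (v w : V) : ⁅r • v, w⁆ = r • ⁅v, w⁆ := by
  rw [← algebraMap_smul 𝕂 r v, ← algebraMap_smul 𝕂 r, smul_lie]

end RealScalars

section Sections

variable {𝕂 : Type*} [RCLike 𝕂]
  {EM : Type*} [NormedAddCommGroup EM] [NormedSpace ℝ EM]
  {M : Type*} [TopologicalSpace M] [ChartedSpace EM M]
  {𝔨 : Type*} [NormedLieRing 𝔨] [NormedLieAlgebra 𝕂 𝔨] [NormedLieAlgebra ℝ 𝔨]
  [IsScalarTower ℝ 𝕂 𝔨] [FiniteDimensional ℝ 𝔨]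
  {L : M → Type*} [∀ x, LieRing (L x)] [∀ x, LieAlgebra 𝕂 (L x)]
  [∀ x, Module ℝ (L x)]
  [∀ x, TopologicalSpace (L x)] [TopologicalSpace (TotalSpace 𝔨 L)] [FiberBundle 𝔨 L]
  [VectorBundle 𝕂 𝔨 L] [VectorBundle ℝ 𝔨 L] [IsLieBundle 𝔨 L] {k : ℕ∞}

variable (𝕂) in
/-- A chart of a bundle of Lie algebras identifies the fibre over a point with the model. -/
def Bundle.Trivialization.lieEquivAt (e : Trivialization 𝔨 (π 𝔨 L)) [MemTrivializationAtlas e]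
    (x : M) (hx : x ∈ e.baseSet) : L x ≃ₗ⁅𝕂⁆ 𝔨 :=
  { e.linearEquivAt 𝕂 x hx with
    map_lie' := fun {v w} => IsLieBundle.map_lie e x hx v w }

/-- The product of a section of `L` with a real function. -/
def fsmul (f : C^k⟮𝓘(ℝ, EM), M; 𝓘(ℝ, ℝ), ℝ⟯) (X : sectionLieAlgebra 𝕂 EM 𝔨 L k) :
    sectionLieAlgebra 𝕂 EM 𝔨 L k :=
  ⟨fun x => f x • X.1 x, ContMDiff.smul_section f.contMDiff X.2⟩

theorem fsmul_apply (f : C^k⟮𝓘(ℝ, EM), M; 𝓘(ℝ, ℝ), ℝ⟯) (X : sectionLieAlgebra 𝕂 EM 𝔨 L k) (x : M) :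
    (fsmul f X).1 x = f x • X.1 x := rfl

theorem fsmul_fsmul (f g : C^k⟮𝓘(ℝ, EM), M; 𝓘(ℝ, ℝ), ℝ⟯) (X : sectionLieAlgebra 𝕂 EM 𝔨 L k) :
    fsmul f (fsmul g X) = fsmul (f * g) X :=
  Subtype.ext (funext fun x => (mul_smul (f x) (g x) (X.1 x)).symm)

theorem add_fsmul (f g : C^k⟮𝓘(ℝ, EM), M; 𝓘(ℝ, ℝ), ℝ⟯) (X : sectionLieAlgebra 𝕂 EM 𝔨 L k) :
    fsmul (f + g) X = fsmul f X + fsmul g X :=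
  Subtype.ext (funext fun x => add_smul (f x) (g x) (X.1 x))

theorem fsmul_add (f : C^k⟮𝓘(ℝ, EM), M; 𝓘(ℝ, ℝ), ℝ⟯) (X Y : sectionLieAlgebra 𝕂 EM 𝔨 L k) :
    fsmul f (X + Y) = fsmul f X + fsmul f Y :=
  Subtype.ext (funext fun x => smul_add (f x) (X.1 x) (Y.1 x))

theorem one_fsmul (X : sectionLieAlgebra 𝕂 EM 𝔨 L k) :
    fsmul (1 : C^k⟮𝓘(ℝ, EM), M; 𝓘(ℝ, ℝ), ℝ⟯) X = X :=
  Subtype.ext (funext fun x => one_smul ℝ (X.1 x))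

theorem zero_fsmul (X : sectionLieAlgebra 𝕂 EM 𝔨 L k) :
    fsmul (0 : C^k⟮𝓘(ℝ, EM), M; 𝓘(ℝ, ℝ), ℝ⟯) X = 0 :=
  Subtype.ext (funext fun x => zero_smul ℝ (X.1 x))

variable [∀ x, IsScalarTower ℝ 𝕂 (L x)]

theorem lie_fsmul (f : C^k⟮𝓘(ℝ, EM), M; 𝓘(ℝ, ℝ), ℝ⟯) (X Y : sectionLieAlgebra 𝕂 EM 𝔨 L k) :
    ⁅Y, fsmul f X⁆ = ⁅fsmul f Y, X⁆ := by
  refine Subtype.ext (funext fun x => ?_)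
  change ⁅Y.1 x, f x • X.1 x⁆ = ⁅f x • Y.1 x, X.1 x⁆
  rw [lie_real_smul (𝕂 := 𝕂), real_smul_lie (𝕂 := 𝕂)]

theorem fsmul_lie (f : C^k⟮𝓘(ℝ, EM), M; 𝓘(ℝ, ℝ), ℝ⟯) (X Y : sectionLieAlgebra 𝕂 EM 𝔨 L k) :
    fsmul f ⁅Y, X⁆ = ⁅Y, fsmul f X⁆ :=
  Subtype.ext (funext fun x => (lie_real_smul (𝕂 := 𝕂) (f x) (Y.1 x) (X.1 x)).symm)

theorem fsmul_smul (f : C^k⟮𝓘(ℝ, EM), M; 𝓘(ℝ, ℝ), ℝ⟯) (c : 𝕂) (X : sectionLieAlgebra 𝕂 EM 𝔨 L k) :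
    fsmul f (c • X) = c • fsmul f X :=
  Subtype.ext (funext fun x => by
    change f x • (c • X.1 x) = c • (f x • X.1 x)
    rw [← algebraMap_smul 𝕂 (f x), ← algebraMap_smul 𝕂 (f x), smul_comm])

theorem smul_fsmul (r : ℝ) (f : C^k⟮𝓘(ℝ, EM), M; 𝓘(ℝ, ℝ), ℝ⟯) (X : sectionLieAlgebra 𝕂 EM 𝔨 L k) :
    fsmul (r • f) X = (algebraMap ℝ 𝕂 r) • fsmul f X :=
  Subtype.ext (funext fun x => by
    change (r * f x) • X.1 x = (algebraMap ℝ 𝕂 r) • (f x • X.1 x)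
    rw [algebraMap_smul, mul_smul])

section Surjection

variable (ψ : sectionLieAlgebra 𝕂 EM 𝔨 L k →ₗ⁅𝕂⁆ 𝔨) [LieAlgebra.IsSimple 𝕂 𝔨]

variable {ψ} in
/-- The element `ψ (f X)` is central in `𝔨`: its bracket with `ψ Y` is `⁅ψ (f Y), ψ X⁆ = 0`. -/
theorem map_fsmul_eq_zero (hψ : Function.Surjective ψ) (f : C^k⟮𝓘(ℝ, EM), M; 𝓘(ℝ, ℝ), ℝ⟯)
    {X : sectionLieAlgebra 𝕂 EM 𝔨 L k} (hX : ψ X = 0) : ψ (fsmul f X) = 0 := by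
  refine LieAlgebra.IsSimple.eq_zero_of_forall_lie_eq_zero (𝕂 := 𝕂) fun w => ?_
  obtain ⟨Y, rfl⟩ := hψ w
  rw [← LieHom.map_lie, lie_fsmul, LieHom.map_lie, hX, lie_zero]

/-- The ideal of all functions that multiply every section into the kernel of `ψ`. -/
def functionAnnihilator : Ideal C^k⟮𝓘(ℝ, EM), M; 𝓘(ℝ, ℝ), ℝ⟯ where
  carrier := {f | ∀ X, ψ (fsmul f X) = 0}
  zero_mem' X := by rw [zero_fsmul, map_zero]
  add_mem' {f g} hf hg X := by rw [add_fsmul, map_add, hf, hg, add_zero]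
  smul_mem' f g hg X := by rw [smul_eq_mul, mul_comm, ← fsmul_fsmul, hg]

variable {ψ}

/-- Multiplication by `f` induces an endomorphism of `𝔨` commuting with all `ad v`, whose kernel is
an ideal: it is injective or zero. -/
theorem mem_functionAnnihilator_of_map_fsmul_eq_zero (hψ : Function.Surjective ψ)
    {f : C^k⟮𝓘(ℝ, EM), M; 𝓘(ℝ, ℝ), ℝ⟯} {X : sectionLieAlgebra 𝕂 EM 𝔨 L k}
    (hX : ψ X ≠ 0) (hfX : ψ (fsmul f X) = 0) : f ∈ functionAnnihilator ψ := by
  intro Y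
  obtain ⟨Z, hZ, hfZ⟩ := LieAlgebra.IsSimple.forall_of_exists (𝕂 := 𝕂)
    (fun v => ∃ Z, ψ Z = v ∧ ψ (fsmul f Z) = 0)
    ⟨0, map_zero ψ, map_fsmul_eq_zero hψ f (map_zero ψ)⟩
    (fun v w ⟨Z, hZ, hZ'⟩ ⟨W, hW, hW'⟩ =>
      ⟨Z + W, by rw [map_add, hZ, hW], by rw [fsmul_add, map_add, hZ', hW', add_zero]⟩)
    (fun c v ⟨Z, hZ, hZ'⟩ =>
      ⟨c • Z, by rw [map_smul, hZ], by rw [fsmul_smul, map_smul, hZ', smul_zero]⟩)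
    (fun v w ⟨Z, hZ, hZ'⟩ => by
      obtain ⟨W, hW⟩ := hψ v
      refine ⟨⁅W, Z⁆, by rw [LieHom.map_lie, hZ, hW], ?_⟩
      rw [fsmul_lie, LieHom.map_lie, hZ', lie_zero]) ⟨X, rfl, hfX⟩ hX (ψ Y)
  have h := map_fsmul_eq_zero hψ f (X := Y - Z) (by rw [map_sub, hZ, sub_self])
  rw [sub_eq_add_neg, ← neg_one_smul 𝕂 Z, fsmul_add, fsmul_smul, map_add, map_smul, hfZ, smul_zero,
    add_zero] at h
  exact h

/-- If `f g` annihilates but `g` does not, then `f` maps some `g Y` outside the kernel of `ψ` into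
this kernel. -/
theorem functionAnnihilator_isPrime (hψ : Function.Surjective ψ) :
    (functionAnnihilator ψ).IsPrime := by
  obtain ⟨v, hv⟩ := @exists_ne _ (LieAlgebra.IsSimple.nontrivial 𝕂 𝔨) (0 : 𝔨)
  obtain ⟨X, rfl⟩ := hψ v
  refine ⟨(Ideal.ne_top_iff_one _).2 fun h => hv (one_fsmul X ▸ h X), fun {f g} hfg => ?_⟩
  by_contra! h
  obtain ⟨Y, hY⟩ := not_forall.1 h.2
  exact h.1 (mem_functionAnnihilator_of_map_fsmul_eq_zero hψ hY (fsmul_fsmul f g Y ▸ hfg Y))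

/-- For a fixed section `X` the elements `ψ (f ^ n • X)` of the finite-dimensional space `𝔨` are
linearly dependent, so some nonzero polynomial in `f` multiplies `X` into the kernel of `ψ`. -/
theorem functionAnnihilator_quotient_isAlgebraic (hψ : Function.Surjective ψ) :
    Algebra.IsAlgebraic ℝ (C^k⟮𝓘(ℝ, EM), M; 𝓘(ℝ, ℝ), ℝ⟯ ⧸ functionAnnihilator ψ) := by
  obtain ⟨v, hv⟩ := @exists_ne _ (LieAlgebra.IsSimple.nontrivial 𝕂 𝔨) (0 : 𝔨)
  obtain ⟨X, rfl⟩ := hψ v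
  refine ⟨fun q => ?_⟩
  obtain ⟨f, rfl⟩ := Ideal.Quotient.mk_surjective q
  let T : Polynomial ℝ →ₗ[ℝ] 𝔨 :=
    { toFun := fun p => ψ (fsmul (Polynomial.aeval f p) X)
      map_add' := fun p q => by rw [map_add, add_fsmul, map_add]
      map_smul' := fun r p => by
        rw [map_smul, smul_fsmul, map_smul, algebraMap_smul, RingHom.id_apply] }
  have hT : ¬ Function.Injective T := fun hinj =>
    Polynomial.not_finite (R := ℝ) (Module.Finite.of_injective T hinj)
  obtain ⟨p, hp, hp0⟩ : ∃ p, T p = 0 ∧ p ≠ 0 := by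
    rw [injective_iff_map_eq_zero] at hT
    push Not at hT
    exact hT
  refine ⟨p, hp0, ?_⟩
  have h := mem_functionAnnihilator_of_map_fsmul_eq_zero hψ hv hp
  rw [← Ideal.Quotient.eq_zero_iff_mem] at h
  rw [← h]
  exact Polynomial.aeval_algHom_apply (Ideal.Quotient.mkₐ ℝ _) f p

end Surjection
end Sections

/-! ### Sections vanishing at a point -/

section Bump

variable {EM : Type*} [NormedAddCommGroup EM] [NormedSpace ℝ EM]
  {M : Type*} [TopologicalSpace M] [ChartedSpace EM M]

theorem contMDiff_smul_of_tsupport {k : ℕ∞} {F : Type*} [NormedAddCommGroup F] [NormedSpace ℝ F]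
    {ρ : C^k⟮𝓘(ℝ, EM), M; 𝓘(ℝ, ℝ), ℝ⟯} {U : Set M} (hρ : tsupport ρ ⊆ U)
    {g : M → F} (hg : ∀ x ∈ U, ContMDiffAt 𝓘(ℝ, EM) 𝓘(ℝ, F) k g x) :
    ContMDiff 𝓘(ℝ, EM) 𝓘(ℝ, F) k (fun x => ρ x • g x) :=
  contMDiff_of_tsupport fun x hx =>
    (ρ.contMDiff x).smul (hg x (hρ (tsupport_smul_subset_left _ _ hx)))

variable [FiniteDimensional ℝ EM] [IsManifold 𝓘(ℝ, EM) ∞ M] [T2Space M]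

theorem exists_contMDiffMap_tsupport_subset (k : ℕ∞) {y : M} {U : Set M} (hU : U ∈ 𝓝 y) :
    ∃ ρ : C^k⟮𝓘(ℝ, EM), M; 𝓘(ℝ, ℝ), ℝ⟯, tsupport ρ ⊆ U ∧ ∀ᶠ x in 𝓝 y, ρ x = 1 := by
  obtain ⟨ρ, -, hρ⟩ := (SmoothBumpFunction.nhds_basis_tsupport (I := 𝓘(ℝ, EM)) y).mem_iff.1 hU
  exact ⟨⟨ρ, ρ.contMDiff.of_le (WithTop.coe_le_coe.2 le_top)⟩, hρ, ρ.eventuallyEq_one⟩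

end Bump

section Sections

variable {𝕂 : Type*} [RCLike 𝕂]
  {EM : Type*} [NormedAddCommGroup EM] [NormedSpace ℝ EM]
  {M : Type*} [TopologicalSpace M] [ChartedSpace EM M]
  {𝔨 : Type*} [NormedLieRing 𝔨] [NormedLieAlgebra 𝕂 𝔨] [NormedLieAlgebra ℝ 𝔨]
  [IsScalarTower ℝ 𝕂 𝔨] [FiniteDimensional ℝ 𝔨]
  {L : M → Type*} [∀ x, LieRing (L x)] [∀ x, LieAlgebra 𝕂 (L x)]
  [∀ x, Module ℝ (L x)]
  [∀ x, TopologicalSpace (L x)] [TopologicalSpace (TotalSpace 𝔨 L)] [FiberBundle 𝔨 L]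
  [VectorBundle 𝕂 𝔨 L] [VectorBundle ℝ 𝔨 L]
  [IsLieBundle 𝔨 L] {k : ℕ∞}

variable (𝕂 EM 𝔨 L k) in
/-- The value of a section at `x`. -/
def evalSection (x : M) : sectionLieAlgebra 𝕂 EM 𝔨 L k →ₗ⁅𝕂⁆ L x where
  toFun X := X.1 x
  map_add' _ _ := rfl
  map_smul' _ _ := rfl
  map_lie' := rfl

variable (𝕂 EM L k) in
/-- The value of a section at `x`, read in a chart. -/
def evalInChart (e : Trivialization 𝔨 (π 𝔨 L)) [MemTrivializationAtlas e] (x : M)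
    (hx : x ∈ e.baseSet) : sectionLieAlgebra 𝕂 EM 𝔨 L k →ₗ⁅𝕂⁆ 𝔨 :=
  (e.lieEquivAt 𝕂 x hx).toLieHom.comp (evalSection 𝕂 EM 𝔨 L k x)

theorem evalInChart_eq_zero_iff (e : Trivialization 𝔨 (π 𝔨 L)) [MemTrivializationAtlas e] {x : M}
    (hx : x ∈ e.baseSet) (X : sectionLieAlgebra 𝕂 EM 𝔨 L k) :
    evalInChart 𝕂 EM L k e x hx X = 0 ↔ X.1 x = 0 :=
  (e.lieEquivAt 𝕂 x hx).toLinearEquiv.map_eq_zero_iff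

theorem sectionLieAlgebra_sum_apply {ι : Type*} (t : Finset ι)
    (X : ι → sectionLieAlgebra 𝕂 EM 𝔨 L k) (x : M) :
    (∑ i ∈ t, X i).1 x = ∑ i ∈ t, (X i).1 x := by
  rw [AddSubmonoidClass.coe_finsetSum, Finset.sum_apply]

variable [FiniteDimensional ℝ EM] [IsManifold 𝓘(ℝ, EM) ∞ M] [T2Space M]
  [ContMDiffVectorBundle ∞ 𝔨 L 𝓘(ℝ, EM)]

variable (𝕂 k) in
/-- Every model vector extends to a global section which is constant near `y` in a given chart. -/
theorem exists_section_eventually_eq (e : Trivialization 𝔨 (π 𝔨 L)) [MemTrivializationAtlas e]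
    {y : M} (hy : y ∈ e.baseSet) (v : 𝔨) :
    ∃ X : sectionLieAlgebra 𝕂 EM 𝔨 L k, ∀ᶠ x in 𝓝 y, (e ⟨x, X.1 x⟩).2 = v := by
  obtain ⟨ρ, hρ, hρ1⟩ := exists_contMDiffMap_tsupport_subset (EM := EM) k
    (e.open_baseSet.mem_nhds hy)
  have hs : ContMDiffOn 𝓘(ℝ, EM) (𝓘(ℝ, EM).prod 𝓘(ℝ, 𝔨)) k
      (fun x => TotalSpace.mk' 𝔨 x (e.symm x v)) e.baseSet := by
    rw [e.contMDiffOn_section_baseSet_iff]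
    exact (contMDiffOn_const (c := v)).congr fun x hx => by rw [e.apply_mk_symm hx]
  refine ⟨⟨_, ContMDiffOn.smul_section_of_tsupport ρ.contMDiff.contMDiffOn e.open_baseSet hρ hs⟩,
    ?_⟩
  filter_upwards [hρ1, e.open_baseSet.mem_nhds hy] with x hx hxe
  change (e ⟨x, ρ x • e.symm x v⟩).2 = v
  rw [hx, one_smul, e.apply_mk_symm hxe]

theorem evalInChart_surjective (e : Trivialization 𝔨 (π 𝔨 L)) [MemTrivializationAtlas e] (x : M)
    (hx : x ∈ e.baseSet) :
    Function.Surjective (evalInChart 𝕂 EM L k e x hx) := fun v => by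
  obtain ⟨X, hX⟩ := exists_section_eventually_eq 𝕂 (EM := EM) k e hx v
  exact ⟨X, hX.self_of_nhds⟩

/-- A section vanishing at `y` is a combination of sections with coefficients vanishing at `y`. -/
theorem exists_eq_sum_fsmul_of_apply_eq_zero {y : M} {X : sectionLieAlgebra 𝕂 EM 𝔨 L k}
    (hX : X.1 y = 0) :
    ∃ (n : ℕ) (f : Fin n → C^k⟮𝓘(ℝ, EM), M; 𝓘(ℝ, ℝ), ℝ⟯)
      (g : C^k⟮𝓘(ℝ, EM), M; 𝓘(ℝ, ℝ), ℝ⟯) (Y : Fin n → sectionLieAlgebra 𝕂 EM 𝔨 L k),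
      (∀ i, f i y = 0) ∧ g y = 0 ∧ X = fsmul g X + ∑ i, fsmul (f i) (Y i) := by
  let e := trivializationAt 𝔨 L y
  have hy : y ∈ e.baseSet := FiberBundle.mem_baseSet_trivializationAt' y
  obtain ⟨ρ, hρ, hρ1⟩ := exists_contMDiffMap_tsupport_subset (EM := EM) k
    (e.open_baseSet.mem_nhds hy)
  let b := Module.finBasis ℝ 𝔨
  let f : Fin (Module.finrank ℝ 𝔨) → C^k⟮𝓘(ℝ, EM), M; 𝓘(ℝ, ℝ), ℝ⟯ := fun i =>
    ⟨_, contMDiff_smul_of_tsupport hρ (g := fun x => e.localFrameCoeff 𝓘(ℝ, EM) b i x (X.1 x))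
      fun x hx => contMDiffAt_localFrameCoeff (e := e) b hx (X.2 x) i⟩
  let Y : Fin (Module.finrank ℝ 𝔨) → sectionLieAlgebra 𝕂 EM 𝔨 L k := fun i =>
    ⟨_, ContMDiffOn.smul_section_of_tsupport ρ.contMDiff.contMDiffOn e.open_baseSet hρ
      (e.contMDiffOn_localFrame_baseSet k b i)⟩
  -- One factor `ρ` of `ρ ^ 2` cuts off the coefficients, the other one the local frame.
  refine ⟨_, f, 1 - ρ * ρ, Y, fun i => ?_, ?_, ?_⟩
  · change ρ y • e.localFrameCoeff 𝓘(ℝ, EM) b i y (X.1 y) = 0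
    rw [hX, map_zero, smul_zero]
  · change 1 - ρ y * ρ y = 0
    rw [hρ1.self_of_nhds, mul_one, sub_self]
  · refine Subtype.ext (funext fun x => ?_)
    change X.1 x = (1 - ρ x * ρ x) • X.1 x + (∑ i, fsmul (f i) (Y i)).1 x
    rw [sectionLieAlgebra_sum_apply]
    change X.1 x = (1 - ρ x * ρ x) • X.1 x +
      ∑ i, (ρ x * e.localFrameCoeff 𝓘(ℝ, EM) b i x (X.1 x)) • (ρ x • e.localFrame b i x)
    by_cases hx : x ∈ e.baseSet
    · have h := e.eq_sum_localFrameCoeff_smul (I := 𝓘(ℝ, EM)) (b := b) (s := X.1) hx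
      have h' : ∑ i, (ρ x * e.localFrameCoeff 𝓘(ℝ, EM) b i x (X.1 x)) • (ρ x • e.localFrame b i x)
          = (ρ x * ρ x) • X.1 x := by
        conv_rhs => rw [h]
        rw [Finset.smul_sum]
        refine Finset.sum_congr rfl fun i _ => ?_
        rw [smul_smul, smul_smul]
        congr 1
        ring
      rw [h', ← add_smul, sub_add_cancel, one_smul]
    · have h0 : ρ x = 0 := image_eq_zero_of_notMem_tsupport fun h => hx (hρ h)
      simp [h0]

variable [∀ x, IsScalarTower ℝ 𝕂 (L x)]

/-- The maximal ideals of the Lie algebra of sections that have a quotient isomorphic to `𝔨` are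
the kernels of the evaluations at points. -/
theorem exists_map_eq_zero_iff_apply_eq_zero [SigmaCompactSpace M] [LieAlgebra.IsSimple 𝕂 𝔨]
    (ψ : sectionLieAlgebra 𝕂 EM 𝔨 L k →ₗ⁅𝕂⁆ 𝔨) (hψ : Function.Surjective ψ) :
    ∃ y : M, ∀ X, ψ X = 0 ↔ X.1 y = 0 := by
  have := functionAnnihilator_isPrime hψ
  have := functionAnnihilator_quotient_isAlgebraic hψ
  obtain ⟨y, hy⟩ := exists_mem_iff_eq_zero_of_isPrime (functionAnnihilator ψ)
  have hye : y ∈ (trivializationAt 𝔨 L y).baseSet := FiberBundle.mem_baseSet_trivializationAt' y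
  refine ⟨y, fun X => ?_⟩
  rw [← evalInChart_eq_zero_iff (trivializationAt 𝔨 L y) hye]
  refine LieHom.ker_iff_of_ker_le _ ψ (evalInChart_surjective _ y hye) hψ (fun X hX => ?_) X
  obtain ⟨n, f, g, Y, hf, hg, hXs⟩ := exists_eq_sum_fsmul_of_apply_eq_zero
    ((evalInChart_eq_zero_iff _ hye X).1 hX)
  rw [hXs, map_add, map_sum, (hy g).2 hg X, zero_add]
  exact Finset.sum_eq_zero fun i _ => (hy (f i)).2 (hf i) (Y i)

end Sections

/-! ### Differentiability of the maps and families induced by an automorphism -/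

section Maps

variable {EM : Type*} [NormedAddCommGroup EM] [NormedSpace ℝ EM]
  {M : Type*} [TopologicalSpace M] [ChartedSpace EM M]

theorem contMDiffAt_clm_of_apply {k : ℕ∞} {V V' : Type*} [NormedAddCommGroup V] [NormedSpace ℝ V]
    [FiniteDimensional ℝ V] [NormedAddCommGroup V'] [NormedSpace ℝ V'] [FiniteDimensional ℝ V']
    {F : M → V →L[ℝ] V'} {x : M}
    (hF : ∀ v, ContMDiffAt 𝓘(ℝ, EM) 𝓘(ℝ, V') k (fun y => F y v) x) :
    ContMDiffAt 𝓘(ℝ, EM) 𝓘(ℝ, V →L[ℝ] V') k F x := by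
  let b := Module.finBasis ℝ V
  let S : (Fin (Module.finrank ℝ V) → V') →L[ℝ] V →L[ℝ] V' := LinearMap.toContinuousLinearMap
    ((LinearMap.toContinuousLinearMap : (V →ₗ[ℝ] V') ≃ₗ[ℝ] _).toLinearMap ∘ₗ
      (b.constr ℝ).toLinearMap)
  have hS : F = fun y => S fun i => F y (b i) := funext fun y => by
    refine ContinuousLinearMap.coe_injective (b.ext fun i => ?_)
    exact (b.constr_basis ℝ (fun i => F y (b i)) i).symm
  rw [hS]
  exact S.contMDiff.contMDiffAt.comp x (contMDiffAt_pi_space.2 fun i => hF (b i))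

variable [FiniteDimensional ℝ EM] [IsManifold 𝓘(ℝ, EM) ∞ M] [T2Space M]

/-- A map is of class `C^k` as soon as it pulls `C^k` functions back to `C^k` functions; bump
functions detect continuity, and cut-off charts differentiability. -/
theorem contMDiff_of_forall_comp {k : ℕ∞} {m : M → M}
    (hm : ∀ f : C^k⟮𝓘(ℝ, EM), M; 𝓘(ℝ, ℝ), ℝ⟯, ContMDiff 𝓘(ℝ, EM) 𝓘(ℝ, ℝ) k (fun x => f (m x))) :
    ContMDiff 𝓘(ℝ, EM) 𝓘(ℝ, EM) k m := by
  have : IsManifold 𝓘(ℝ, EM) k M := IsManifold.of_le (n := ∞) (WithTop.coe_le_coe.2 le_top)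
  intro z
  have hcont : ContinuousAt m z := by
    intro U hU
    obtain ⟨ρ, hρ, hρ1⟩ := exists_contMDiffMap_tsupport_subset (EM := EM) k hU
    have h1 : ρ (m z) ≠ 0 := by rw [hρ1.self_of_nhds]; exact one_ne_zero
    rw [Filter.mem_map]
    filter_upwards [(hm ρ).continuous.continuousAt.eventually_ne h1] with x hx
    exact hρ (subset_tsupport _ hx)
  rw [contMDiffAt_iff_target]
  refine ⟨hcont, ?_⟩
  obtain ⟨ρ, hρ, hρ1⟩ := exists_contMDiffMap_tsupport_subset (EM := EM) k
    ((isOpen_extChartAt_source (I := 𝓘(ℝ, EM)) (m z)).mem_nhds (mem_extChartAt_source (m z)))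
  let b := Module.finBasis ℝ EM
  have hcoord : ∀ i, ContMDiff 𝓘(ℝ, EM) 𝓘(ℝ, ℝ) k
      (fun x => ρ (m x) • b.repr (extChartAt 𝓘(ℝ, EM) (m z) (m x)) i) := fun i =>
    hm ⟨_, contMDiff_smul_of_tsupport hρ
      (g := fun y => b.repr (extChartAt 𝓘(ℝ, EM) (m z) y) i) fun y hy =>
        ((LinearMap.toContinuousLinearMap (b.coord i)).contMDiff.contMDiffAt.comp y
          (contMDiffAt_extChartAt' (by rwa [extChartAt_source] at hy)))⟩
  have hsum : ContMDiff 𝓘(ℝ, EM) 𝓘(ℝ, EM) k (fun x =>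
      ∑ i, (ρ (m x) • b.repr (extChartAt 𝓘(ℝ, EM) (m z) (m x)) i) • b i) :=
    contMDiff_finsetSum fun i _ => (hcoord i).smul contMDiff_const
  refine hsum.contMDiffAt.congr_of_eventuallyEq ?_
  filter_upwards [hcont.eventually hρ1] with x hx
  simp only [hx, one_smul, b.sum_repr, Function.comp]

end Maps

section Kernels

variable {R Γ A B : Type*} [CommRing R] [LieRing Γ] [LieAlgebra R Γ] [LieRing A] [LieAlgebra R A]
  [LieRing B] [LieAlgebra R B]

/-- Two surjections with the same kernel differ by an isomorphism of their targets. -/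
theorem LieHom.exists_lieEquiv_of_ker_iff (φ : Γ →ₗ⁅R⁆ A) (ψ : Γ →ₗ⁅R⁆ B)
    (hφ : Function.Surjective φ) (hψ : Function.Surjective ψ) (h : ∀ X, ψ X = 0 ↔ φ X = 0) :
    ∃ κ : A ≃ₗ⁅R⁆ B, ∀ X, ψ X = κ (φ X) := by
  have hiff : ∀ X Y, ψ X = ψ Y ↔ φ X = φ Y := fun X Y => by
    rw [← sub_eq_zero, ← map_sub, h, map_sub, sub_eq_zero]
  choose s hs using hφ
  have hsφ : ∀ X, ψ (s (φ X)) = ψ X := fun X => (hiff _ _).2 (hs _)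
  let κ : A →ₗ⁅R⁆ B :=
    { toFun := fun a => ψ (s a)
      map_add' := fun a a' => by
        rw [← map_add]
        exact (hiff _ _).2 (by simp [hs])
      map_smul' := fun c a => by
        rw [RingHom.id_apply, ← map_smul]
        exact (hiff _ _).2 (by simp [hs])
      map_lie' := fun {a a'} => by
        rw [← LieHom.map_lie]
        exact (hiff _ _).2 (by simp [hs]) }
  have hκ : Function.Bijective κ := by
    refine ⟨fun a a' haa' => ?_, fun c => ?_⟩
    · rw [← hs a, ← hs a']
      exact (hiff _ _).1 haa'
    · obtain ⟨X, rfl⟩ := hψ c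
      exact ⟨φ X, hsφ X⟩
  exact ⟨LieEquiv.ofBijective κ hκ, fun X => (hsφ X).symm⟩

end Kernels

section Sections

variable {𝕂 : Type*} [RCLike 𝕂]
  {EM : Type*} [NormedAddCommGroup EM] [NormedSpace ℝ EM]
  {M : Type*} [TopologicalSpace M] [ChartedSpace EM M]
  {𝔨 : Type*} [NormedLieRing 𝔨] [NormedLieAlgebra ℝ 𝔨]
  [FiniteDimensional ℝ 𝔨]
  {L : M → Type*} [∀ x, LieRing (L x)] [∀ x, LieAlgebra 𝕂 (L x)] [∀ x, Module ℝ (L x)]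
  [∀ x, TopologicalSpace (L x)] [TopologicalSpace (TotalSpace 𝔨 L)] [FiberBundle 𝔨 L]
  [VectorBundle ℝ 𝔨 L] {k : ℕ∞}

section Charts

variable [∀ x, IsScalarTower ℝ 𝕂 (L x)]

/-- The expression `e'_y ∘ T ∘ e_x⁻¹` of a map `T : L x → L y` in two charts around `x` and `y`; for
`y = l x` it is `LieIsoBundle.inCharts`. -/
def chartExpr {x y : M} (e e' : Trivialization 𝔨 (π 𝔨 L)) [MemTrivializationAtlas e]
    [MemTrivializationAtlas e'] (T : L x ≃ₗ⁅𝕂⁆ L y) : 𝔨 →L[ℝ] 𝔨 :=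
  LinearMap.toContinuousLinearMap
    (e'.linearMapAt ℝ y ∘ₗ (T : L x →ₗ[𝕂] L y).restrictScalars ℝ ∘ₗ e.symmₗ ℝ x)

theorem chartExpr_apply {x y : M} (e e' : Trivialization 𝔨 (π 𝔨 L)) [MemTrivializationAtlas e]
    [MemTrivializationAtlas e'] (T : L x ≃ₗ⁅𝕂⁆ L y) (hx : x ∈ e.baseSet)
    (hy : y ∈ e'.baseSet) (v : 𝔨) :
    chartExpr e e' T v = (e' ⟨y, T (e.symm x v)⟩).2 := by
  change e'.linearMapAt ℝ y (T (e.symmₗ ℝ x v)) = _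
  rw [e'.coe_linearMapAt_of_mem hy, e.symmₗ_apply hx]

theorem chartExpr_trans {x y z : M} (e e' e'' : Trivialization 𝔨 (π 𝔨 L))
    [MemTrivializationAtlas e] [MemTrivializationAtlas e'] [MemTrivializationAtlas e'']
    (S : L x ≃ₗ⁅𝕂⁆ L y) (T : L y ≃ₗ⁅𝕂⁆ L z) (hx : x ∈ e.baseSet) (hy : y ∈ e'.baseSet)
    (hz : z ∈ e''.baseSet) :
    chartExpr e e'' (S.trans T) = (chartExpr e' e'' T).comp (chartExpr e e' S) := by
  ext v
  rw [ContinuousLinearMap.comp_apply, chartExpr_apply _ _ _ hx hz, chartExpr_apply _ _ _ hy hz,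
    chartExpr_apply _ _ _ hx hy, e'.symm_apply_apply_mk hy]
  rfl

/-- Composition with a `C^k` family of isomorphisms `T x : L (l x) → L (l' x)` preserves `C^k`
maps into the bundles of isomorphisms. -/
theorem LieIsoBundle.IsCkOn.trans {l l' : M → M} (hl : Continuous l)
    (T : ∀ x, L (l x) ≃ₗ⁅𝕂⁆ L (l' x))
    (hT : ∀ (e e' : Trivialization 𝔨 (π 𝔨 L)) [MemTrivializationAtlas e]
      [MemTrivializationAtlas e'], ∀ x, l x ∈ e.baseSet → l' x ∈ e'.baseSet →
        ContMDiffAt 𝓘(ℝ, EM) 𝓘(ℝ, 𝔨 →L[ℝ] 𝔨) k (fun x => chartExpr e e' (T x)) x)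
    {EN : Type*} [NormedAddCommGroup EN] [NormedSpace ℝ EN] {N : Type*} [TopologicalSpace N]
    [ChartedSpace EN N] {γ : N → LieIsoBundle 𝕂 L l} {W : Set N}
    (hγ : LieIsoBundle.IsCkOn EM 𝔨 k EN γ W) :
    LieIsoBundle.IsCkOn EM 𝔨 k EN
      (fun y => (⟨(γ y).1, (γ y).2.trans (T (γ y).1)⟩ : LieIsoBundle 𝕂 L l')) W := by
  refine ⟨hγ.1, fun e e'' _ _ y hy => ?_⟩
  obtain ⟨hyW, hye, hye''⟩ := hy
  let e' := trivializationAt 𝔨 L (l (γ y).1)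
  have hye' : l (γ y).1 ∈ e'.baseSet := FiberBundle.mem_baseSet_trivializationAt' _
  set S : Set N := W ∩ {y | (γ y).1 ∈ e.baseSet ∧ l' (γ y).1 ∈ e''.baseSet}
  have hbase : ContMDiffWithinAt 𝓘(ℝ, EN) 𝓘(ℝ, EM) k (fun y => (γ y).1) S y :=
    (hγ.1 y hyW).mono inter_subset_left
  have hev : ∀ᶠ z in 𝓝[S] y, l (γ z).1 ∈ e'.baseSet :=
    (hl.continuousAt.comp_continuousWithinAt hbase.continuousWithinAt).eventually
      (e'.open_baseSet.mem_nhds hye')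
  have hmem : W ∩ {y | (γ y).1 ∈ e.baseSet ∧ l (γ y).1 ∈ e'.baseSet} ∈ 𝓝[S] y := by
    filter_upwards [hev, self_mem_nhdsWithin] with z hz hzS
    exact ⟨hzS.1, hzS.2.1, hz⟩
  have h1 := (hγ.2 e e' y ⟨hyW, hye, hye'⟩).mono_of_mem_nhdsWithin hmem
  have h2 := (hT e' e'' (γ y).1 hye' hye'').comp_contMDiffWithinAt y hbase
  refine (h2.clm_comp h1).congr_of_eventuallyEq_of_mem ?_ ⟨hyW, hye, hye''⟩
  filter_upwards [hev, self_mem_nhdsWithin] with z hz hzS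
  exact chartExpr_trans e e' e'' (γ z).2 (T (γ z).1) hzS.2.1 hz hzS.2.2

end Charts

variable [NormedLieAlgebra 𝕂 𝔨] [VectorBundle 𝕂 𝔨 L] [IsScalarTower ℝ 𝕂 𝔨]
  [FiniteDimensional ℝ EM] [IsManifold 𝓘(ℝ, EM) ∞ M] [T2Space M]
  [ContMDiffVectorBundle ∞ 𝔨 L 𝓘(ℝ, EM)] [IsLieBundle 𝔨 L]

variable (𝕂 EM 𝔨 L k) in
theorem evalSection_surjective (x : M) :
    Function.Surjective (evalSection 𝕂 EM 𝔨 L k x) := fun v => by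
  have hx : x ∈ (trivializationAt 𝔨 L x).baseSet := FiberBundle.mem_baseSet_trivializationAt' x
  obtain ⟨X, hX⟩ := evalInChart_surjective (𝕂 := 𝕂) (EM := EM) (k := k) _ x hx
    ((trivializationAt 𝔨 L x).lieEquivAt 𝕂 x hx v)
  exact ⟨X, ((trivializationAt 𝔨 L x).lieEquivAt 𝕂 x hx).injective hX⟩

/-- Sections separate points, because `𝔨` is not zero. -/
theorem eq_of_forall_apply_eq_zero [Nontrivial 𝔨] {x y : M}
    (h : ∀ X : sectionLieAlgebra 𝕂 EM 𝔨 L k, X.1 x = 0 → X.1 y = 0) : x = y := by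
  by_contra hxy
  obtain ⟨ρ, hρ, hρ1⟩ := exists_contMDiffMap_tsupport_subset (EM := EM) k
    (isOpen_compl_singleton.mem_nhds (Ne.symm hxy) : {x}ᶜ ∈ 𝓝 y)
  obtain ⟨v, hv⟩ := exists_ne (0 : 𝔨)
  have hy : y ∈ (trivializationAt 𝔨 L y).baseSet := FiberBundle.mem_baseSet_trivializationAt' y
  obtain ⟨X, rfl⟩ := evalInChart_surjective (𝕂 := 𝕂) (EM := EM) (k := k) _ y hy v
  have h0 : ρ x = 0 := image_eq_zero_of_notMem_tsupport fun h => hρ h rfl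
  have := h (fsmul ρ X) (by rw [fsmul_apply, h0, zero_smul])
  rw [fsmul_apply, hρ1.self_of_nhds, one_smul] at this
  exact hv ((evalInChart_eq_zero_iff _ hy X).2 this)

variable [∀ x, IsScalarTower ℝ 𝕂 (L x)]

/-- A family of isomorphisms which carries `C^k` sections to `C^k` sections is of class `C^k`:
apply it to sections that are constant in a chart. -/
theorem contMDiffAt_chartExpr {a b : M → M} (ha : Continuous a)
    (hb : ContMDiff 𝓘(ℝ, EM) 𝓘(ℝ, EM) k b) (T : ∀ x, L (a x) ≃ₗ⁅𝕂⁆ L (b x))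
    (ν : sectionLieAlgebra 𝕂 EM 𝔨 L k → sectionLieAlgebra 𝕂 EM 𝔨 L k)
    (hν : ∀ X x, (ν X).1 (b x) = T x (X.1 (a x)))
    (e e' : Trivialization 𝔨 (π 𝔨 L)) [MemTrivializationAtlas e] [MemTrivializationAtlas e'] {x : M}
    (hx : a x ∈ e.baseSet) (hx' : b x ∈ e'.baseSet) :
    ContMDiffAt 𝓘(ℝ, EM) 𝓘(ℝ, 𝔨 →L[ℝ] 𝔨) k (fun x => chartExpr e e' (T x)) x := by
  refine contMDiffAt_clm_of_apply fun v => ?_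
  obtain ⟨X, hX⟩ := exists_section_eventually_eq 𝕂 (EM := EM) k e hx v
  have h := ((e'.contMDiffAt_section_iff hx').1 ((ν X).2 (b x))).comp x (hb x)
  refine h.congr_of_eventuallyEq ?_
  filter_upwards [ha.continuousAt.eventually hX,
    ha.continuousAt.eventually (e.open_baseSet.mem_nhds hx),
    hb.continuous.continuousAt.eventually (e'.open_baseSet.mem_nhds hx')] with y hy hye hye'
  rw [chartExpr_apply _ _ _ hye hye', ← hy, e.symm_apply_apply_mk hye, ← hν]
  rfl

/-- An automorphism permutes the maximal ideals given by the points of `M`. -/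
theorem exists_apply_eq_zero_iff [SigmaCompactSpace M] [LieAlgebra.IsSimple 𝕂 𝔨]
    (μ : sectionLieAlgebra 𝕂 EM 𝔨 L k ≃ₗ⁅𝕂⁆ sectionLieAlgebra 𝕂 EM 𝔨 L k) :
    ∃ m : M → M, ∀ x X, (μ X).1 x = 0 ↔ X.1 (m x) = 0 := by
  suffices h : ∀ x, ∃ y, ∀ X, (μ X).1 x = 0 ↔ X.1 y = 0 by
    choose m hm using h
    exact ⟨m, hm⟩
  intro x
  have hx : x ∈ (trivializationAt 𝔨 L x).baseSet := FiberBundle.mem_baseSet_trivializationAt' x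
  obtain ⟨y, hy⟩ := exists_map_eq_zero_iff_apply_eq_zero
    ((evalInChart 𝕂 EM L k _ x hx).comp μ.toLieHom)
    ((evalInChart_surjective _ x hx).comp μ.surjective)
  exact ⟨y, fun X => (evalInChart_eq_zero_iff _ hx (μ X)).symm.trans (hy X)⟩

/-- If `μ` moves the ideal of `m x` to the ideal of `x`, then it intertwines multiplication by `f`
with multiplication by `f ∘ m`. Hence `f ∘ m` times any section is a `C^k` section. -/
theorem contMDiff_of_apply_eq_zero_iff [LieAlgebra.IsSimple 𝕂 𝔨]
    (μ : sectionLieAlgebra 𝕂 EM 𝔨 L k ≃ₗ⁅𝕂⁆ sectionLieAlgebra 𝕂 EM 𝔨 L k) {m : M → M}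
    (hm : ∀ x X, (μ X).1 x = 0 ↔ X.1 (m x) = 0) : ContMDiff 𝓘(ℝ, EM) 𝓘(ℝ, EM) k m := by
  refine contMDiff_of_forall_comp fun f x => ?_
  have hf : ∀ X z, (μ (fsmul f X)).1 z = f (m z) • (μ X).1 z := fun X z => by
    have h : (μ (fsmul f X - (algebraMap ℝ 𝕂 (f (m z))) • X)).1 z = 0 := by
      rw [hm]
      change f (m z) • X.1 (m z) - (algebraMap ℝ 𝕂 (f (m z))) • X.1 (m z) = 0
      rw [algebraMap_smul, sub_self]
    rw [map_sub, map_smul] at h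
    change (μ (fsmul f X)).1 z - (algebraMap ℝ 𝕂 (f (m z))) • (μ X).1 z = 0 at h
    rwa [algebraMap_smul, sub_eq_zero] at h
  have := LieAlgebra.IsSimple.nontrivial 𝕂 𝔨
  obtain ⟨v, hv⟩ := exists_ne (0 : 𝔨)
  -- Near `x` the function `f ∘ m` is a coordinate of `(f ∘ m) Y`, since `Y` is constant there.
  obtain ⟨φ, hφ⟩ := SeparatingDual.exists_eq_one (R := ℝ) hv
  let e := trivializationAt 𝔨 L x
  have hx : x ∈ e.baseSet := FiberBundle.mem_baseSet_trivializationAt' x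
  obtain ⟨Y, hY⟩ := exists_section_eventually_eq 𝕂 (EM := EM) k e hx v
  have h := (e.contMDiffAt_section_iff hx).1 ((μ (fsmul f (μ.symm Y))).2 x)
  refine (φ.contMDiff.contMDiffAt.comp x h).congr_of_eventuallyEq ?_
  filter_upwards [hY, e.open_baseSet.mem_nhds hx] with z hz hze
  have hlin : (e ⟨z, f (m z) • Y.1 z⟩).2 = f (m z) • (e ⟨z, Y.1 z⟩).2 :=
    (e.linear ℝ hze).map_smul _ _
  change f (m z) = φ (e ⟨z, (μ (fsmul f (μ.symm Y))).1 z⟩).2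
  rw [hf, μ.apply_symm_apply, hlin, hz, map_smul, hφ, smul_eq_mul, mul_one]

end Sections

end

/-! ### The automorphism as a family of fibre isomorphisms over a diffeomorphism -/

theorem mainTheorem10
    {𝕂 : Type*} [RCLike 𝕂]
    {EM : Type*} [NormedAddCommGroup EM] [NormedSpace ℝ EM] [FiniteDimensional ℝ EM]
    {M : Type*} [TopologicalSpace M] [ChartedSpace EM M] [IsManifold 𝓘(ℝ, EM) ∞ M]
    [T2Space M] [ParacompactSpace M] [ConnectedSpace M]
    {𝔨 : Type*} [NormedLieRing 𝔨] [NormedLieAlgebra 𝕂 𝔨] [NormedLieAlgebra ℝ 𝔨]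
    [IsScalarTower ℝ 𝕂 𝔨] [FiniteDimensional ℝ 𝔨]
    {L : M → Type*} [∀ x, LieRing (L x)] [∀ x, LieAlgebra 𝕂 (L x)]
    [∀ x, Module ℝ (L x)] [∀ x, IsScalarTower ℝ 𝕂 (L x)]
    [∀ x, TopologicalSpace (L x)] [TopologicalSpace (TotalSpace 𝔨 L)] [FiberBundle 𝔨 L]
    [VectorBundle 𝕂 𝔨 L] [VectorBundle ℝ 𝔨 L] [ContMDiffVectorBundle ∞ 𝔨 L 𝓘(ℝ, EM)]
    [IsLieBundle 𝔨 L]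
    (h : ((RCLike.I : 𝕂) ≠ 0 ∧ LieAlgebra.IsSimple 𝕂 𝔨) ∨
      ((RCLike.I : 𝕂) = 0 ∧ LieAlgebra.IsSimple 𝕂 𝔨 ∧ IsLieAlgebraOfCompactLieGroup.{w} 𝔨))
    (k : ℕ∞) (μ : sectionLieAlgebra 𝕂 EM 𝔨 L k ≃ₗ⁅𝕂⁆ sectionLieAlgebra 𝕂 EM 𝔨 L k) :
    ∃ (l : M ≃ₘ^k⟮𝓘(ℝ, EM), 𝓘(ℝ, EM)⟯ M) (κ : ∀ x, L x ≃ₗ⁅𝕂⁆ L (l x)),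
      IsCkLieIsoSection EM 𝔨 k κ ∧
      (∀ (X : sectionLieAlgebra 𝕂 EM 𝔨 L k) (x : M), (μ X).1 (l x) = κ x (X.1 x)) ∧
      IsCkBundleIso EM 𝔨 k (l := l) (l' := id)
        (fun p : LieIsoBundle 𝕂 L l =>
          (⟨p.1, p.2.trans (κ p.1).symm⟩ : LieIsoBundle 𝕂 L id)) := by
  have : LocallyCompactSpace M := Manifold.locallyCompact_of_finiteDimensional 𝓘(ℝ, EM)
  have : SigmaCompactSpace M := sigmaCompactSpace_of_connectedSpace
  have : LieAlgebra.IsSimple 𝕂 𝔨 := h.elim And.right fun h => h.2.1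
  have : Nontrivial 𝔨 := LieAlgebra.IsSimple.nontrivial 𝕂 𝔨
  -- `m` and `l` give the action of `μ` and `μ⁻¹` on the ideals of points; they are inverse maps
  -- because sections separate points.
  obtain ⟨m, hm⟩ := exists_apply_eq_zero_iff μ
  obtain ⟨l, hl⟩ := exists_apply_eq_zero_iff μ.symm
  have hlm : ∀ x, l (m x) = x := fun x => eq_of_forall_apply_eq_zero (𝕂 := 𝕂) (k := k) (EM := EM)
    (𝔨 := 𝔨) (L := L) fun X hX => by rwa [← hl, ← hm, μ.apply_symm_apply] at hX
  have hml : ∀ x, m (l x) = x := fun x => eq_of_forall_apply_eq_zero (𝕂 := 𝕂) (k := k) (EM := EM)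
    (𝔨 := 𝔨) (L := L) fun X hX => by rwa [← hm, ← hl, μ.symm_apply_apply] at hX
  have hmC := contMDiff_of_apply_eq_zero_iff μ hm
  have hlC := contMDiff_of_apply_eq_zero_iff μ.symm hl
  have hκ : ∀ x, ∃ κ : L x ≃ₗ⁅𝕂⁆ L (l x), ∀ X : sectionLieAlgebra 𝕂 EM 𝔨 L k,
      (μ X).1 (l x) = κ (X.1 x) := fun x =>
    LieHom.exists_lieEquiv_of_ker_iff (evalSection 𝕂 EM 𝔨 L k x)
      ((evalSection 𝕂 EM 𝔨 L k (l x)).comp μ.toLieHom) (evalSection_surjective 𝕂 EM 𝔨 L k x)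
      ((evalSection_surjective 𝕂 EM 𝔨 L k (l x)).comp μ.surjective)
      fun X => (hm (l x) X).trans (by rw [hml]; rfl)
  choose κ hκ using hκ
  have hκC : ∀ (e e' : Trivialization 𝔨 (π 𝔨 L)) [MemTrivializationAtlas e]
      [MemTrivializationAtlas e'], ∀ x, x ∈ e.baseSet → l x ∈ e'.baseSet →
        ContMDiffAt 𝓘(ℝ, EM) 𝓘(ℝ, 𝔨 →L[ℝ] 𝔨) k (fun x => chartExpr e e' (κ x)) x :=
    fun e e' _ _ x hx hx' =>
      contMDiffAt_chartExpr (a := id) continuous_id hlC κ μ (fun X x => hκ x X) e e' hx hx'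
  have hκC' : ∀ (e e' : Trivialization 𝔨 (π 𝔨 L)) [MemTrivializationAtlas e]
      [MemTrivializationAtlas e'], ∀ x, l x ∈ e.baseSet → x ∈ e'.baseSet →
        ContMDiffAt 𝓘(ℝ, EM) 𝓘(ℝ, 𝔨 →L[ℝ] 𝔨) k (fun x => chartExpr e e' (κ x).symm) x :=
    fun e e' _ _ x hx hx' =>
      contMDiffAt_chartExpr (b := id) hlC.continuous contMDiff_id (fun x => (κ x).symm) μ.symm
        (fun X x => by
          change (μ.symm X).1 x = (κ x).symm (X.1 (l x))
          rw [← (κ x).symm_apply_apply ((μ.symm X).1 x), ← hκ, μ.apply_symm_apply]) e e' hx hx'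
  -- `IsCkLieIsoSection` unfolds to the differentiability of `chartExpr`.
  refine ⟨⟨⟨l, m, hml, hlm⟩, hlC, hmC⟩, κ, ⟨contMDiff_id.contMDiffOn, fun e e' _ _ x hx =>
    (hκC e e' x hx.2.1 hx.2.2).contMDiffWithinAt⟩, fun X x => hκ x X, ⟨?_, ?_⟩, fun p => rfl, ?_⟩
  · rintro ⟨x, f⟩ ⟨y, g⟩ hfg
    obtain rfl : x = y := congrArg Sigma.fst hfg
    have hfg' : f.trans (κ x).symm = g.trans (κ x).symm := eq_of_heq (Sigma.mk.inj hfg).2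
    refine congrArg (Sigma.mk x) (LieEquiv.ext fun v => (κ x).symm.injective ?_)
    exact congrArg (fun F : L x ≃ₗ⁅𝕂⁆ L x => F v) hfg'
  · rintro ⟨x, f⟩
    refine ⟨⟨x, LieEquiv.trans f (κ x)⟩, congrArg (Sigma.mk x) (LieEquiv.ext fun v => ?_)⟩
    exact (κ x).symm_apply_apply (f v)
  · intro n W _ γ
    refine ⟨fun hγ => hγ.trans (l' := id) hlC.continuous (fun x => (κ x).symm) hκC', fun hγ => ?_⟩
    have h := hγ.trans (l' := l) continuous_id κ hκC
    -- `γ` is recovered from its image by composing with `κ`.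
    have hγ' : γ = fun y => ⟨(γ y).1, ((γ y).2.trans (κ (γ y).1).symm).trans (κ (γ y).1)⟩ :=
      funext fun y => congrArg (Sigma.mk (γ y).1)
        (LieEquiv.ext fun v => ((κ (γ y).1).apply_symm_apply ((γ y).2 v)).symm)
    rw [hγ']
    exact h
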